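/- Let $q$ be a prime power and let $V$ be a finite-dimensional vector space over $\mathbb{F}_q$, of dimension $n$, equipped with a non-degenerate alternating bilinear form, a non-degenerate quadratic form, or a non-degenerate Hermitian form (with respect to a field automorphism of order $2$; then $q$ is a square). A subspace of $V$ is totally isotropic if the form vanishes identically on it. Let $\mathcal P$ be the classical polar space consisting of all totally isotropic subspaces of $V$, let $d$ be its Witt index, that is, the largest dimension of a totally isotropic subspace, and assume $d\ge 1$. The points of $\mathcal P$ are its $1$-dimensional members and the generators are its $d$-dimensional members. Put $e=1$ in the symplectic case, $e=n-2d\in\{0,1,2\}$ in the orthogonal (quadratic) case, and $e=n-2d+\tfrac12\in\{\tfrac12,\tfrac32\}$ in the Hermitian case. The dual polar graph $\Gamma(q,d,e)$ of $\mathcal P$ has the generators as vertices, two being adjacent if and only if their intersection has dimension $d-1$. The metric dimension $\mu(\Gamma)$ of a finite connected graph $\Gamma$ is the smallest size of a set $S$ of vertices such that any two distinct vertices $u,w$ satisfy $\mathrm{d}(u,x)\ne \mathrm{d}(w,x)$ for some $x\in S$. Let $M$ be the $0/1$ incidence matrix with rows indexed by the generators and columns by the points of $\mathcal P$, with entry $1$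 exactly when the point is contained in the generator. **Theorem.** The metric dimension of $\Gamma(q,d,e)$ is at most the rank of $M$ over $\mathbb{R}$, that is, $$\mu(\Gamma(q,d,e))\;\le\;\operatorname{rank}_{\mathbb R}(M)\;=\;\frac{(q^{d+e-1}+1)(q^{d+e-1}-q^{e-1}+q-1)}{(q^{e-1}+1)(q-1)}.$$ -/

import Mathlib

/-- A set `S` of vertices is resolving if any two distinct vertices are told apart by their
distance to some member of `S`. The distance is the length of a shortest path, with value `⊤` if
there is none; in a connected graph it is the usual integer-valued distance. -/
def IsResolvingSet {V : Type*} (G : SimpleGraph V) (S : Set V) : Prop :=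
  ∀ u w : V, u ≠ w → ∃ x ∈ S, G.edist u x ≠ G.edist w x

/-- The metric dimension of a finite graph: the smallest size of a resolving set. (The set of all
vertices is resolving, so the infimum is a minimum.) -/
noncomputable def metricDimension {V : Type*} [Finite V] (G : SimpleGraph V) : ℕ :=
  sInf {k : ℕ | ∃ S : Finset V, IsResolvingSet G (S : Set V) ∧ S.card = k}

/-- A classical polar space on the vector space `V` over `F`, given by the form defining it:
a non-degenerate alternating bilinear form, a non-degenerate quadratic form (in any
characteristic), or a non-degenerate Hermitian form with respect to a field automorphism `σ` of
order two. -/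
inductive ClassicalPolarSpace (F V : Type*) [Field F] [AddCommGroup V] [Module F V]
  | symplectic (B : LinearMap.BilinForm F V) (alt : LinearMap.IsAlt B)
      (nondeg : LinearMap.Nondegenerate B)
  | orthogonal (Q : QuadraticForm F V) (nondeg : QuadraticMap.Nondegenerate (Q := Q))
  | hermitian (σ : F →+* F) (σ_ne : σ ≠ RingHom.id F) (σ_invol : ∀ a, σ (σ a) = a)
      (H : V →ₛₗ[σ] V →ₗ[F] F) (herm : LinearMap.IsSymm H) (nondeg : LinearMap.Nondegenerate H)

namespace ClassicalPolarSpace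

variable {F V : Type*} [Field F] [AddCommGroup V] [Module F V]

/-- Totally isotropic subspaces: the form vanishes identically on `U`. -/
def IsTotallyIsotropic : ClassicalPolarSpace F V → Submodule F V → Prop
  | symplectic B _ _, U => ∀ v ∈ U, ∀ w ∈ U, B v w = 0
  | orthogonal Q _, U => ∀ v ∈ U, Q v = 0
  | hermitian _ _ _ H _ _, U => ∀ v ∈ U, ∀ w ∈ U, H v w = 0

/-- The Witt index: the largest dimension of a totally isotropic subspace. -/
noncomputable def wittIndex (P : ClassicalPolarSpace F V) : ℕ :=
  sSup {k : ℕ | ∃ U : Submodule F V, P.IsTotallyIsotropic U ∧ Module.finrank F U = k}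

/-- The parameter `e` of a polar space of Witt index `d` on a space of dimension `n`. It is `1` for
symplectic spaces (where `n = 2d`). For orthogonal spaces it is `n - 2d`: `0` for hyperbolic
quadrics (`n = 2d`), `1` for parabolic quadrics (`n = 2d + 1`), `2` for elliptic quadrics
(`n = 2d + 2`). For Hermitian spaces it is `n - 2d + 1/2`: `1/2` if `n = 2d` and `3/2` if
`n = 2d + 1`. -/
noncomputable def parameterE : ClassicalPolarSpace F V → ℝ
  | symplectic _ _ _ => 1
  | P@(orthogonal _ _) => (Module.finrank F V : ℝ) - 2 * (P.wittIndex : ℝ)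
  | P@(hermitian _ _ _ _ _ _) => (Module.finrank F V : ℝ) - 2 * (P.wittIndex : ℝ) + 1 / 2

/-- The totally isotropic subspaces of dimension `t`. -/
def Omega (P : ClassicalPolarSpace F V) (t : ℕ) : Type _ :=
  {U : Submodule F V // P.IsTotallyIsotropic U ∧ Module.finrank F U = t}

/-- The points of the polar space. -/
abbrev Point (P : ClassicalPolarSpace F V) : Type _ := P.Omega 1

/-- The generators (maximals) of the polar space. -/
abbrev Generator (P : ClassicalPolarSpace F V) : Type _ := P.Omega P.wittIndex

instance finite_Omega [Finite F] [FiniteDimensional F V] (P : ClassicalPolarSpace F V) (t : ℕ) :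
    Finite (P.Omega t) := by
  have : Finite V := Module.finite_of_finite F
  have : Finite (Submodule F V) := Finite.of_injective _ (SetLike.coe_injective (A := Submodule F V))
  exact Subtype.finite

noncomputable instance fintype_Omega [Finite F] [FiniteDimensional F V]
    (P : ClassicalPolarSpace F V) (t : ℕ) : Fintype (P.Omega t) :=
  Fintype.ofFinite _

/-- The dual polar graph: two generators are adjacent if and only if their intersection has
dimension one less than the Witt index. -/
def dualPolarGraph (P : ClassicalPolarSpace F V) : SimpleGraph P.Generator where
  Adj U W := Module.finrank F (U.1 ⊓ W.1 : Submodule F V) + 1 = P.wittIndex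
  symm := ⟨fun U W h => by rwa [inf_comm]⟩
  loopless := ⟨fun U h => by
    have := U.2.2
    rw [inf_idem] at h
    omega⟩

open Classical in
/-- The incidence matrix of the polar space: rows are indexed by generators, columns by points. -/
noncomputable def incidenceMatrix (P : ClassicalPolarSpace F V) :
    Matrix P.Generator P.Point ℝ :=
  fun U x => if x.1 ≤ U.1 then 1 else 0

end ClassicalPolarSpace

/-!
The inner product of two rows of the incidence matrix counts the points in the intersection of two
generators, so it depends only on the dimension of the intersection, that is, on the distance of
the generators in the dual polar graph. Hence two generators with the same distances to a set `S`
of generators have rows whose difference is orthogonal to the rows from `S`. If these rows span the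
row space then the difference is orthogonal to itself, so `S` is resolving, and `S` can be chosen
of size the rank.

The rank comes from an identity `Aᵀ * A * Aᵀ = μ • Aᵀ + κ • J` for the incidence matrix `A`, where
`J` is the all-ones matrix: subtracting a multiple of `J` from `μ⁻¹ • A` gives a generalized
inverse `B` of `Aᵀ`, and the rank is the trace of the idempotent matrix `Aᵀ * B`. The numbers of
points and generators that enter are obtained by double counting, starting from the number of
isotropic vectors `v + t • u` for `u` isotropic and not orthogonal to `v`.
-/

section MetricDimension

open Matrix

variable {K V n : Type*} [Field K] [Fintype n]

theorem exists_finset_card_le_rank_forall_row_mem_span [Finite V] (A : Matrix V n K) :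
    ∃ S : Finset V, S.card ≤ A.rank ∧ ∀ v, A.row v ∈ Submodule.span K (A.row '' S) := by
  classical
  obtain ⟨f, hf, hspan, -⟩ := Submodule.exists_fun_fin_finrank_span_eq K (Set.range A.row)
  choose g hg using hf
  have himage : A.row '' (Finset.univ.image g : Finset V) = Set.range f := by
    rw [Finset.coe_image, Finset.coe_univ, Set.image_univ, ← Set.range_comp]
    exact congrArg Set.range (funext hg)
  refine ⟨Finset.univ.image g, ?_, fun v => ?_⟩
  · simpa [A.rank_eq_finrank_span_row] using Finset.card_image_le (s := Finset.univ) (f := g)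
  · rw [himage, hspan]
    exact Submodule.subset_span ⟨v, rfl⟩

variable [LinearOrder K] [IsStrictOrderedRing K] {G : SimpleGraph V} {A : Matrix V n K}

theorem isResolvingSet_of_forall_row_mem_span (hA : Function.Injective A.row)
    (hdist : ∀ u w x, G.edist u x = G.edist w x → A.row u ⬝ᵥ A.row x = A.row w ⬝ᵥ A.row x)
    {S : Set V} (hS : ∀ v, A.row v ∈ Submodule.span K (A.row '' S)) : IsResolvingSet G S := by
  intro u w huw
  by_contra! hequal
  have horth : ∀ r ∈ Submodule.span K (A.row '' S), (A.row u - A.row w) ⬝ᵥ r = 0 := by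
    intro r hr
    induction hr using Submodule.span_induction with
    | mem _ hr =>
      obtain ⟨x, hx, rfl⟩ := hr
      rw [sub_dotProduct, hdist u w x (hequal x hx), sub_self]
    | zero => exact dotProduct_zero _
    | add r r' _ _ hr hr' => rw [dotProduct_add, hr, hr', add_zero]
    | smul c r _ hr => rw [dotProduct_smul, hr, smul_zero]
  exact huw (hA (sub_eq_zero.1 (dotProduct_self_eq_zero.1 (horth _ (sub_mem (hS u) (hS w))))))

theorem metricDimension_le_rank [Finite V] (hA : Function.Injective A.row)
    (hdist : ∀ u w x, G.edist u x = G.edist w x → A.row u ⬝ᵥ A.row x = A.row w ⬝ᵥ A.row x) :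
    metricDimension G ≤ A.rank := by
  obtain ⟨S, hcard, hspan⟩ := exists_finset_card_le_rank_forall_row_mem_span A
  refine le_trans (Nat.sInf_le ⟨S, ?_, rfl⟩) hcard
  exact isResolvingSet_of_forall_row_mem_span hA hdist hspan

end MetricDimension

section RankFormula

open Matrix

variable {K m n : Type*} [Field K] [Fintype m] [Fintype n]

theorem cast_rank_eq_trace_of_mul_mul_self {A : Matrix m n K} {B : Matrix n m K}
    (h : A * B * A = A) : (A.rank : K) = (A * B).trace := by
  classical
  have hidem : IsIdempotentElem (toLin' (A * B)) := by
    rw [IsIdempotentElem, Module.End.mul_eq_comp, ← toLin'_mul, ← Matrix.mul_assoc, h]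
  have hrank : (A * B).rank = A.rank := by
    refine le_antisymm (rank_mul_le_left A B) ?_
    conv_lhs => rw [← h]
    exact rank_mul_le_left _ _
  rw [← hrank, ← trace_toLin'_eq, (LinearMap.IsIdempotentElem.isProj_range _ hidem).trace]
  rfl

theorem cast_rank_eq_of_transpose_mul_self_mul_transpose {A : Matrix m n K} {r s κ μ : K}
    (hrow : ∀ i, ∑ j, A i j = s) (hcol : ∀ j, ∑ i, A i j = r) (hr : r ≠ 0) (hs : s ≠ 0)
    (hμ : μ ≠ 0) (hA : Aᵀ * A * Aᵀ = μ • Aᵀ + of fun _ _ => κ) :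
    (A.rank : K) = μ⁻¹ * (Aᵀ * A).trace - κ / (μ * s) * Fintype.card n := by
  set γ : K := κ / (μ * r * s) with hγ
  let B : Matrix m n K := μ⁻¹ • A - of fun _ _ => γ
  have hAB : Aᵀ * B = μ⁻¹ • (Aᵀ * A) - of fun _ _ => r * γ := by
    rw [Matrix.mul_sub, Matrix.mul_smul]
    congr 1
    ext j j'
    simp [mul_apply, ← Finset.sum_mul, hcol]
  have hABA : Aᵀ * B * Aᵀ = Aᵀ := by
    rw [hAB, Matrix.sub_mul, Matrix.smul_mul, hA]
    ext j i
    simp only [Matrix.sub_apply, Matrix.smul_apply, Matrix.add_apply, mul_apply, of_apply,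
      transpose_apply, smul_eq_mul, ← Finset.mul_sum, hrow, hγ]
    field_simp
    ring
  rw [← rank_transpose, cast_rank_eq_trace_of_mul_mul_self hABA, hAB, trace_sub, trace_smul]
  simp only [trace, diag_apply, of_apply, Finset.sum_const, Finset.card_univ, nsmul_eq_mul,
    smul_eq_mul, hγ]
  field_simp

end RankFormula

section DoubleCounting

theorem sum_boole_eq_ncard {α R : Type*} [Fintype α] [NonAssocSemiring R] (p : α → Prop)
    [DecidablePred p] : ∑ x, (if p x then 1 else 0 : R) = {x | p x}.ncard := by
  rw [Finset.sum_boole, Set.ncard_eq_toFinset_card', Set.toFinset_ofPred]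

theorem ncard_mul_eq_ncard_mul_of_rel {α β R : Type*} [Finite α] [Finite β]
    [NonAssocSemiring R] (r : α → β → Prop) {s : Set α} {t : Set β} {a b : R}
    (ha : ∀ x ∈ s, ({y ∈ t | r x y}.ncard : R) = a)
    (hb : ∀ y ∈ t, ({x ∈ s | r x y}.ncard : R) = b) : s.ncard * a = t.ncard * b := by
  classical
  have := Fintype.ofFinite α
  have := Fintype.ofFinite β
  have hcount := congrArg (Nat.cast : ℕ → R)
    (Finset.sum_card_bipartiteAbove_eq_sum_card_bipartiteBelow
      (s := s.toFinset) (t := t.toFinset) r)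
  have hab x : (t.toFinset.bipartiteAbove r x).card = {y ∈ t | r x y}.ncard := by
    rw [← Set.ncard_coe_finset, Finset.coe_bipartiteAbove]
    simp
  have hbe y : (s.toFinset.bipartiteBelow r y).card = {x ∈ s | r x y}.ncard := by
    rw [← Set.ncard_coe_finset, Finset.coe_bipartiteBelow]
    simp
  push_cast [hab, hbe] at hcount
  rwa [Finset.sum_eq_card_nsmul fun x hx => ha x (Set.mem_toFinset.1 hx),
    Finset.sum_eq_card_nsmul fun y hy => hb y (Set.mem_toFinset.1 hy), nsmul_eq_mul, nsmul_eq_mul,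
    ← Set.ncard_eq_toFinset_card', ← Set.ncard_eq_toFinset_card'] at hcount

end DoubleCounting

section LinearAlgebra

open Module Submodule

variable {F V : Type*} [Field F] [AddCommGroup V] [Module F V]

theorem finrank_range_of_injective_of_bijective {W : Type*} [AddCommGroup W] [Module F W]
    {σ : F →+* F} [RingHomSurjective σ] (hσ : Function.Bijective σ) {f : V →ₛₗ[σ] W}
    (hf : Function.Injective f) : finrank F (LinearMap.range f) = finrank F V := by
  let j : V ≃+ LinearMap.range f := AddEquiv.ofBijective f.rangeRestrict
    ⟨fun v w h => hf (congrArg Subtype.val h), f.surjective_rangeRestrict⟩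
  have hrank := lift_rank_eq_of_equiv_equiv σ j hσ fun c v => map_smulₛₗ f.rangeRestrict c v
  simpa [finrank] using (congrArg Cardinal.toNat hrank).symm

theorem finrank_inf_ker_add_one [FiniteDimensional F V] {U : Submodule F V} {f : V →ₗ[F] F}
    (h : ¬ U ≤ LinearMap.ker f) :
    finrank F (U ⊓ LinearMap.ker f : Submodule F V) + 1 = finrank F U := by
  have hf : f.domRestrict U ≠ 0 := fun h0 => h fun u hu => LinearMap.congr_fun h0 ⟨u, hu⟩
  rw [← Dual.finrank_ker_add_one_of_ne_zero hf, LinearMap.ker_domRestrict,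
    ← map_comap_subtype, finrank_map_subtype_eq]

variable [FiniteDimensional F V]

theorem ncard_coe_submodule (U : Submodule F V) :
    (U : Set V).ncard = Nat.card F ^ finrank F U := by
  rw [← natCard_eq_pow_finrank]
  rfl

variable [Finite F]

theorem ncard_coe_submodule_sdiff {T U : Submodule F V} (h : T ≤ U) :
    ((U \ T : Set V).ncard : ℝ) = Nat.card F ^ finrank F U - Nat.card F ^ finrank F T := by
  have : Finite V := finite_of_finite F
  have hadd := Set.ncard_sdiff_add_ncard_of_subset (s := (T : Set V)) (t := U) h
  rw [ncard_coe_submodule, ncard_coe_submodule] at hadd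
  rw [eq_sub_iff_add_eq]
  exact_mod_cast hadd

theorem ncard_coe_submodule_sdiff_ker {U : Submodule F V} {f : V →ₗ[F] F}
    (h : ¬ U ≤ LinearMap.ker f) :
    ((U \ LinearMap.ker f : Set V).ncard : ℝ) * Nat.card F =
      Nat.card F ^ finrank F U * (Nat.card F - 1) := by
  rw [← Set.sdiff_inter_self_eq_sdiff, Set.inter_comm, ← coe_inf,
    ncard_coe_submodule_sdiff inf_le_left, ← finrank_inf_ker_add_one h]
  ring

end LinearAlgebra

section Involution

variable {F : Type*} [Field F] {σ : F →+* F}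

theorem exists_add_map_eq_of_map_eq_self (hσ : σ ≠ RingHom.id F) (hσσ : ∀ a, σ (σ a) = a) {h : F}
    (hh : σ h = h) : ∃ s, s + σ s = h := by
  obtain ⟨s, hs⟩ : ∃ s, s + σ s ≠ 0 := by
    by_contra! htrace
    refine hσ (RingHom.ext fun x => ?_)
    have hone := htrace 1
    rw [map_one] at hone
    rw [RingHom.id_apply]
    linear_combination htrace x - x * hone
  refine ⟨s * (h / (s + σ s)), ?_⟩
  rw [map_mul, map_div₀, map_add, hσσ, hh, add_comm (σ s) s, ← add_mul, mul_div_cancel₀ _ hs]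

theorem ncard_add_mul_add_map_mul_eq_zero (hσ : σ ≠ RingHom.id F) (hσσ : ∀ a, σ (σ a) = a) {c h : F}
    (hc : c ≠ 0) (hh : σ h = h) :
    {t | h + (t * c + σ (t * c)) = 0}.ncard = {s | s + σ s = 0}.ncard := by
  obtain ⟨s₀, hs₀⟩ := exists_add_map_eq_of_map_eq_self hσ hσσ hh
  let shift : F ≃ F := (Equiv.mulRight₀ c hc).trans (Equiv.addRight s₀)
  rw [← Set.ncard_preimage_of_injective_subset_range (s := {s | s + σ s = 0}) shift.injective
    (by simp [shift.surjective.range_eq])]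
  congr 1
  ext t
  simp only [shift, Set.mem_ofPred_eq, Set.mem_preimage, Equiv.trans_apply, Equiv.coe_addRight,
    Equiv.mulRight₀_apply, map_add, ← hs₀]
  constructor <;> exact fun hst => by linear_combination hst

-- The trace `s ↦ s + σ s` has the fixed field as its image, and multiplication by an element
-- negated by `σ` maps the fixed field onto the kernel.
theorem sq_ncard_add_map_eq_zero (hσ : σ ≠ RingHom.id F) (hσσ : ∀ a, σ (σ a) = a) :
    {s | s + σ s = 0}.ncard ^ 2 = Nat.card F := by
  let trace : F →+ F := AddMonoidHom.id F + σ.toAddMonoidHom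
  have hrange : (trace.range : Set F) = {x | σ x = x} := by
    ext x
    refine ⟨?_, exists_add_map_eq_of_map_eq_self hσ hσσ⟩
    rintro ⟨y, rfl⟩
    simp [trace, hσσ, add_comm]
  obtain ⟨a, ha⟩ : ∃ a, σ a ≠ a := by
    by_contra! hid
    exact hσ (RingHom.ext hid)
  have hb : a - σ a ≠ 0 := sub_ne_zero.2 ha.symm
  have hfixed : {x | σ x = x}.ncard = {s | s + σ s = 0}.ncard := by
    rw [← Set.ncard_preimage_of_injective_subset_range (s := {s | s + σ s = 0})
      (Equiv.mulRight₀ _ hb).injective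
      ((Equiv.mulRight₀ _ hb).surjective.range_eq ▸ Set.subset_univ _)]
    congr 1
    ext x
    simp only [Set.mem_ofPred_eq, Set.mem_preimage, Equiv.mulRight₀_apply, map_mul, map_sub, hσσ]
    rw [← neg_sub a, mul_neg, ← sub_eq_add_neg, ← sub_mul, mul_eq_zero_iff_right hb, sub_eq_zero,
      eq_comm]
  rw [sq, ← trace.ker.card_mul_index, AddSubgroup.index_ker]
  congr 1
  exact (hfixed.symm.trans (congrArg Set.ncard hrange.symm))

end Involution

namespace ClassicalPolarSpace

variable {F V : Type*} [Field F] [AddCommGroup V] [Module F V]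

/-- The field automorphism with respect to which the form of a polar space is semilinear in its
first argument. -/
def companion : ClassicalPolarSpace F V → F →+* F
  | symplectic _ _ _ => RingHom.id F
  | orthogonal _ _ => RingHom.id F
  | hermitian σ _ _ _ _ _ => σ

/-- The reflexive sesquilinear form of a polar space. For a quadratic form it is the polar form,
which controls orthogonality but in characteristic two not isotropy. -/
noncomputable def form : (P : ClassicalPolarSpace F V) → V →ₛₗ[P.companion] V →ₗ[F] F
  | symplectic B _ _ => B
  | orthogonal Q _ => Q.polarBilin
  | hermitian _ _ _ H _ _ => H

/-- Isotropic vectors. For a quadratic form these are its zeros, which in characteristic two are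
fewer than the self-orthogonal vectors. -/
def IsIsotropic : ClassicalPolarSpace F V → V → Prop
  | symplectic _ _ _, _ => True
  | orthogonal Q _, v => Q v = 0
  | hermitian _ _ _ H _ _, v => H v v = 0

/-- The number of isotropic points other than `⟨u⟩` on a line through an isotropic point `⟨u⟩` that
is not contained in the perp of `u`. -/
noncomputable def hyperbolicOrder : ClassicalPolarSpace F V → ℕ
  | symplectic _ _ _ => Nat.card F
  | orthogonal _ _ => 1
  | hermitian σ _ _ _ _ _ => {s | s + σ s = 0}.ncard

section Form

open Submodule

variable {P : ClassicalPolarSpace F V} {T U : Submodule F V} {u v w : V}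

theorem companion_involutive (P : ClassicalPolarSpace F V) : Function.Involutive P.companion := by
  cases P with
  | symplectic => exact fun _ => rfl
  | orthogonal => exact fun _ => rfl
  | hermitian _ _ hσσ => exact hσσ

instance (P : ClassicalPolarSpace F V) : RingHomSurjective P.companion :=
  ⟨P.companion_involutive.surjective⟩

theorem form_symplectic_apply (B : LinearMap.BilinForm F V) (alt : LinearMap.IsAlt B)
    (nondeg : LinearMap.Nondegenerate B) : (symplectic B alt nondeg).form v w = B v w :=
  rfl

theorem form_orthogonal_apply (Q : QuadraticForm F V)
    (nondeg : QuadraticMap.Nondegenerate (Q := Q)) :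
    (orthogonal Q nondeg).form v w = QuadraticMap.polar Q v w :=
  rfl

theorem form_hermitian_apply (σ : F →+* F) (hσ : σ ≠ RingHom.id F) (hσσ : ∀ a, σ (σ a) = a)
    (H : V →ₛₗ[σ] V →ₗ[F] F) (herm : LinearMap.IsSymm H) (nondeg : LinearMap.Nondegenerate H) :
    (hermitian σ hσ hσσ H herm nondeg).form v w = H v w :=
  rfl

theorem isRefl_form (P : ClassicalPolarSpace F V) : P.form.IsRefl := by
  cases P with
  | symplectic _ alt => exact alt.isRefl
  | orthogonal Q =>
    exact fun v w h => by simpa [form_orthogonal_apply, QuadraticMap.polar_comm Q w v] using h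
  | hermitian _ _ _ _ herm => exact herm.isRefl

theorem form_self (hv : P.IsIsotropic v) : P.form v v = 0 := by
  cases P with
  | symplectic _ alt => exact alt v
  | orthogonal Q => simp_all [form_orthogonal_apply, IsIsotropic]
  | hermitian => exact hv

theorem IsIsotropic.smul (hv : P.IsIsotropic v) (c : F) : P.IsIsotropic (c • v) := by
  cases P <;> simp_all [IsIsotropic, QuadraticMap.map_smul]

theorem IsIsotropic.add (hv : P.IsIsotropic v) (hw : P.IsIsotropic w) (h : P.form v w = 0) :
    P.IsIsotropic (v + w) := by
  cases P with
  | symplectic => trivial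
  | orthogonal Q => simp_all [form_orthogonal_apply, IsIsotropic, QuadraticMap.map_add Q]
  | hermitian _ _ _ _ herm =>
    simp_all [form_hermitian_apply, IsIsotropic, herm.isRefl v w h]

theorem isTotallyIsotropic_iff : P.IsTotallyIsotropic U ↔
    (∀ v ∈ U, P.IsIsotropic v) ∧ ∀ v ∈ U, ∀ w ∈ U, P.form v w = 0 := by
  cases P with
  | symplectic => simp [IsTotallyIsotropic, IsIsotropic, form_symplectic_apply]
  | orthogonal Q =>
    refine ⟨fun h => ⟨h, fun v hv w hw => ?_⟩, And.left⟩
    have hQ : ∀ u ∈ U, Q u = 0 := h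
    rw [form_orthogonal_apply, QuadraticMap.polar, hQ _ (U.add_mem hv hw), hQ v hv, hQ w hw,
      sub_zero, sub_zero]
  | hermitian => exact ⟨fun h => ⟨fun v hv => h v hv v hv, h⟩, And.right⟩

theorem IsIsotropic.eq_zero_of_form_eq_zero (hu : P.IsIsotropic u) (h : P.form u = 0) :
    u = 0 := by
  cases P with
  | symplectic _ _ nondeg => exact nondeg.1 u (LinearMap.congr_fun h)
  | orthogonal Q nondeg =>
    rw [← mem_bot F, ← nondeg.radical_eq_bot, QuadraticMap.mem_radical_iff']
    refine ⟨hu, fun v => ?_⟩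
    rw [QuadraticMap.map_add Q, show Q u = 0 from hu, zero_add]
    exact add_eq_left.2 (LinearMap.congr_fun h v)
  | hermitian _ _ _ _ _ nondeg => exact nondeg.1 u (LinearMap.congr_fun h)

theorem ncard_isIsotropic_add_smul (hu : P.IsIsotropic u) (h : P.form u v ≠ 0) :
    {t : F | P.IsIsotropic (v + t • u)}.ncard = P.hyperbolicOrder := by
  cases P with
  | symplectic => simp [IsIsotropic, hyperbolicOrder, Set.ncard_univ]
  | orthogonal Q =>
    replace hu : Q u = 0 := hu
    replace h : QuadraticMap.polar Q u v ≠ 0 := h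
    refine Set.ncard_eq_one.2 ⟨-Q v / QuadraticMap.polar Q u v, Set.ext fun t => ?_⟩
    simp only [IsIsotropic, Set.mem_ofPred_eq, Set.mem_singleton_iff, QuadraticMap.map_add Q,
      QuadraticMap.map_smul, QuadraticMap.polar_comm Q v, QuadraticMap.polar_smul_left, hu,
      smul_eq_mul, mul_zero, add_zero, eq_div_iff h, eq_neg_iff_add_eq_zero]
    rw [add_comm]
  | hermitian σ hσ hσσ H herm =>
    rw [hyperbolicOrder, ← ncard_add_mul_add_map_mul_eq_zero hσ hσσ
      (fun h' => h (herm.isRefl _ _ h')) (herm.eq v v)]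
    congr! 3 with t
    have hHu : H u u = 0 := hu
    simp [IsIsotropic, hHu, herm.eq v u, add_assoc]

theorem isTotallyIsotropic_bot (P : ClassicalPolarSpace F V) : P.IsTotallyIsotropic ⊥ := by
  cases P <;> simp [IsTotallyIsotropic]

theorem IsTotallyIsotropic.mono (hU : P.IsTotallyIsotropic U) (h : T ≤ U) :
    P.IsTotallyIsotropic T := by
  rw [isTotallyIsotropic_iff] at hU ⊢
  exact ⟨fun v hv => hU.1 v (h hv), fun v hv w hw => hU.2 v (h hv) w (h hw)⟩

theorem IsTotallyIsotropic.isIsotropic (hU : P.IsTotallyIsotropic U) (hu : u ∈ U) :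
    P.IsIsotropic u :=
  (isTotallyIsotropic_iff.1 hU).1 u hu

/-- The subspace of all vectors orthogonal to `T`. -/
noncomputable abbrev perp (P : ClassicalPolarSpace F V) (T : Submodule F V) : Submodule F V :=
  T.orthogonalBilin P.form

theorem IsTotallyIsotropic.le_perp (hU : P.IsTotallyIsotropic U) : U ≤ P.perp U :=
  fun w hw v hv => (isTotallyIsotropic_iff.1 hU).2 v hv w hw

theorem mem_perp_span_singleton : w ∈ P.perp (span F {v}) ↔ P.form v w = 0 := by
  rw [mem_orthogonalBilin_iff]
  refine ⟨fun h => h v (mem_span_singleton_self v), fun h x hx => ?_⟩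
  obtain ⟨c, rfl⟩ := mem_span_singleton.1 hx
  simp [h]

theorem perp_sup (P : ClassicalPolarSpace F V) (T U : Submodule F V) :
    P.perp (T ⊔ U) = P.perp T ⊓ P.perp U := by
  refine le_antisymm (le_inf (orthogonalBilin_le le_sup_left) (orthogonalBilin_le le_sup_right)) ?_
  rintro w ⟨hT, hU⟩ v hv
  obtain ⟨y, hy, z, hz, rfl⟩ := mem_sup.1 hv
  rw [map_add, LinearMap.add_apply, hT y hy, hU z hz, add_zero]

theorem IsTotallyIsotropic.sup (hT : P.IsTotallyIsotropic T) (hU : P.IsTotallyIsotropic U)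
    (h : U ≤ P.perp T) : P.IsTotallyIsotropic (T ⊔ U) := by
  have hperp : T ⊔ U ≤ P.perp (T ⊔ U) := by
    rw [perp_sup]
    refine le_inf (sup_le hT.le_perp h) (sup_le (fun t ht u hu => ?_) hU.le_perp)
    exact P.isRefl_form _ _ (h hu t ht)
  refine isTotallyIsotropic_iff.2 ⟨fun x hx => ?_, fun v hv w hw => hperp hw v hv⟩
  obtain ⟨y, hy, z, hz, rfl⟩ := mem_sup.1 hx
  exact (hT.isIsotropic hy).add (hU.isIsotropic hz) (h hz y hy)

theorem IsIsotropic.span_singleton (hv : P.IsIsotropic v) :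
    P.IsTotallyIsotropic (span F {v}) := by
  refine isTotallyIsotropic_iff.2 ⟨fun x hx => ?_, fun x hx y hy => ?_⟩
  · obtain ⟨c, rfl⟩ := mem_span_singleton.1 hx
    exact hv.smul c
  · obtain ⟨c, rfl⟩ := mem_span_singleton.1 hx
    obtain ⟨c', rfl⟩ := mem_span_singleton.1 hy
    simp [form_self hv]

theorem IsTotallyIsotropic.sup_span_singleton (hT : P.IsTotallyIsotropic T)
    (hv : P.IsIsotropic v) (h : v ∈ P.perp T) : P.IsTotallyIsotropic (T ⊔ span F {v}) :=
  hT.sup hv.span_singleton ((span_singleton_le_iff_mem _ _).2 h)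

theorem IsTotallyIsotropic.finrank_perp_add_finrank [FiniteDimensional F V]
    (hT : P.IsTotallyIsotropic T) :
    Module.finrank F (P.perp T) + Module.finrank F T = Module.finrank F V := by
  have hinj : Function.Injective (P.form.domRestrict T) := by
    refine (injective_iff_map_eq_zero _).2 fun t ht => Subtype.ext ?_
    exact (hT.isIsotropic t.2).eq_zero_of_form_eq_zero ht
  have hperp : P.perp T = (LinearMap.range (P.form.domRestrict T)).dualCoannihilator := by
    ext w
    simp [mem_orthogonalBilin_iff, mem_dualCoannihilator]
  rw [hperp, ← finrank_range_of_injective_of_bijective P.companion_involutive.bijective hinj,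
    add_comm]
  exact Subspace.finrank_add_finrank_dualCoannihilator_eq _

theorem not_perp_le_ker_form [FiniteDimensional F V] (hT : P.IsTotallyIsotropic T)
    (hu : P.IsIsotropic u) (huperp : u ∈ P.perp T) (huT : u ∉ T) :
    ¬ P.perp T ≤ LinearMap.ker (P.form u) := by
  intro hle
  have hsup := (hT.sup_span_singleton hu huperp).finrank_perp_add_finrank
  have hperp : P.perp (T ⊔ span F {u}) = P.perp T := by
    rw [perp_sup]
    exact inf_eq_left.2 fun w hw => mem_perp_span_singleton.2 (hle hw)
  rw [finrank_sup_span_singleton huT, hperp] at hsup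
  have := hT.finrank_perp_add_finrank
  omega

end Form

section Generator

open Module Submodule

variable [FiniteDimensional F V] {P : ClassicalPolarSpace F V} {T : Submodule F V}

theorem IsTotallyIsotropic.finrank_le_wittIndex (hT : P.IsTotallyIsotropic T) :
    finrank F T ≤ P.wittIndex :=
  le_csSup ⟨finrank F V, by rintro _ ⟨W, -, rfl⟩; exact W.finrank_le⟩ ⟨T, hT, rfl⟩

theorem nonempty_generator (P : ClassicalPolarSpace F V) : Nonempty P.Generator := by
  obtain ⟨U, hU, hrank⟩ := Nat.sSup_mem
    (s := {k | ∃ U : Submodule F V, P.IsTotallyIsotropic U ∧ finrank F U = k})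
    ⟨_, ⊥, P.isTotallyIsotropic_bot, rfl⟩
    ⟨finrank F V, by rintro _ ⟨W, -, rfl⟩; exact W.finrank_le⟩
  exact ⟨⟨U, hU, hrank⟩⟩

theorem finrank_inf_le_wittIndex (T : Submodule F V) (U : P.Generator) :
    finrank F (T ⊓ U.1 : Submodule F V) ≤ P.wittIndex :=
  (finrank_mono inf_le_right).trans U.2.2.le

theorem Generator.eq_of_le {U W : P.Generator} (h : U.1 ≤ W.1) : U = W :=
  Subtype.ext (eq_of_le_of_finrank_eq h (U.2.2.trans W.2.2.symm))

theorem mem_generator_of_mem_perp (U : P.Generator) {v : V} (hv : P.IsIsotropic v)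
    (h : v ∈ P.perp U.1) : v ∈ U.1 := by
  by_contra hU
  have hrank := (U.2.1.sup_span_singleton hv h).finrank_le_wittIndex
  rw [finrank_sup_span_singleton hU, U.2.2] at hrank
  omega

theorem not_generator_le_ker_form (U : P.Generator) {v : V} (hv : P.IsIsotropic v)
    (h : v ∉ U.1) : ¬ U.1 ≤ LinearMap.ker (P.form v) :=
  fun hle => h (mem_generator_of_mem_perp U hv fun _ hu => P.isRefl_form _ _ (hle hu))

theorem exists_adj_mem_inf_ker_form_le (U : P.Generator) {v : V} (hv : P.IsIsotropic v)
    (h : v ∉ U.1) : ∃ W : P.Generator, P.dualPolarGraph.Adj U W ∧ v ∈ W.1 ∧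
      U.1 ⊓ LinearMap.ker (P.form v) ≤ W.1 := by
  set H := U.1 ⊓ LinearMap.ker (P.form v)
  have hrank : finrank F H + 1 = P.wittIndex :=
    (finrank_inf_ker_add_one (not_generator_le_ker_form U hv h)).trans U.2.2
  have hvH : v ∉ H := fun hvH => h hvH.1
  let W : P.Generator := ⟨H ⊔ span F {v},
    (U.2.1.mono inf_le_left).sup_span_singleton hv fun u hu => P.isRefl_form _ _ hu.2,
    (finrank_sup_span_singleton hvH).trans hrank⟩
  have hvW : v ∈ W.1 := mem_sup_right (mem_span_singleton_self v)
  refine ⟨W, ?_, hvW, le_sup_left⟩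
  have hle : finrank F H ≤ finrank F (U.1 ⊓ W.1 : Submodule F V) :=
    finrank_mono (le_inf inf_le_left le_sup_left)
  have hlt : finrank F (U.1 ⊓ W.1 : Submodule F V) < finrank F W.1 :=
    finrank_lt_finrank_of_lt (inf_lt_right.2 fun hWU => h (hWU hvW))
  rw [W.2.2] at hlt
  change finrank F (U.1 ⊓ W.1 : Submodule F V) + 1 = P.wittIndex
  omega

theorem exists_adj_finrank_inf_lt (U : P.Generator) (hT : P.IsTotallyIsotropic T)
    (h : ¬ T ≤ U.1) : ∃ W : P.Generator, P.dualPolarGraph.Adj U W ∧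
      finrank F (T ⊓ U.1 : Submodule F V) < finrank F (T ⊓ W.1 : Submodule F V) := by
  obtain ⟨v, hvT, hvU⟩ := SetLike.not_le_iff_exists.1 h
  obtain ⟨W, hadj, hvW, hle⟩ := exists_adj_mem_inf_ker_form_le U (hT.isIsotropic hvT) hvU
  refine ⟨W, hadj, finrank_lt_finrank_of_lt (lt_of_le_of_ne ?_ fun heq => ?_)⟩
  · exact fun x hx => ⟨hx.1, hle ⟨hx.2, hT.le_perp hx.1 v hvT⟩⟩
  · exact hvU (heq.ge ⟨hvT, hvW⟩).2

theorem IsTotallyIsotropic.exists_le_generator (hT : P.IsTotallyIsotropic T) :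
    ∃ U : P.Generator, T ≤ U.1 := by
  have := nonempty_generator P
  let codim (U : P.Generator) : ℕ := P.wittIndex - finrank F (T ⊓ U.1 : Submodule F V)
  refine ⟨Function.argmin codim, ?_⟩
  by_contra hTU
  obtain ⟨W, -, hlt⟩ := exists_adj_finrank_inf_lt _ hT hTU
  have hle := finrank_inf_le_wittIndex T W
  exact Function.not_lt_argmin codim W (Nat.sub_lt_sub_left (hlt.trans_le hle) hlt)

theorem wittIndex_le_finrank_inf_add_length {U W : P.Generator}
    (p : P.dualPolarGraph.Walk U W) :
    P.wittIndex ≤ finrank F (U.1 ⊓ W.1 : Submodule F V) + p.length := by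
  induction p with
  | @nil U => rw [inf_idem, U.2.2]; exact Nat.le_add_right _ _
  | @cons U U' W hadj p ih =>
    replace hadj : finrank F (U.1 ⊓ U'.1 : Submodule F V) + 1 = P.wittIndex := hadj
    have hdim := finrank_sup_add_finrank_inf_eq (U.1 ⊓ U'.1) (U'.1 ⊓ W.1)
    have hsup : finrank F (U.1 ⊓ U'.1 ⊔ U'.1 ⊓ W.1 : Submodule F V) ≤ finrank F U'.1 :=
      finrank_mono (sup_le inf_le_right inf_le_left)
    have hinf : finrank F (U.1 ⊓ U'.1 ⊓ (U'.1 ⊓ W.1) : Submodule F V) ≤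
        finrank F (U.1 ⊓ W.1 : Submodule F V) :=
      finrank_mono (inf_le_inf inf_le_left inf_le_right)
    rw [U'.2.2] at hsup
    rw [SimpleGraph.Walk.length_cons]
    omega

theorem exists_walk_length_le (U W : P.Generator) :
    ∃ p : P.dualPolarGraph.Walk U W,
      p.length ≤ P.wittIndex - finrank F (W.1 ⊓ U.1 : Submodule F V) := by
  induction hk : P.wittIndex - finrank F (W.1 ⊓ U.1 : Submodule F V)
    using Nat.strong_induction_on generalizing U with
  | _ k ih =>
    by_cases hle : W.1 ≤ U.1
    · obtain rfl := Generator.eq_of_le hle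
      exact ⟨.nil, Nat.zero_le _⟩
    · obtain ⟨U', hadj, hlt⟩ := exists_adj_finrank_inf_lt U W.2.1 hle
      have := finrank_inf_le_wittIndex W.1 U'
      obtain ⟨p, hp⟩ := ih _ (by omega) U' rfl
      exact ⟨.cons hadj p, by rw [SimpleGraph.Walk.length_cons]; omega⟩

theorem edist_dualPolarGraph (U W : P.Generator) : P.dualPolarGraph.edist U W =
    (P.wittIndex - finrank F (U.1 ⊓ W.1 : Submodule F V) : ℕ) := by
  refine le_antisymm ?_ (le_iInf fun p => ?_)
  · obtain ⟨p, hp⟩ := exists_walk_length_le U W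
    rw [inf_comm] at hp
    exact (SimpleGraph.edist_le p).trans (Nat.cast_le.2 hp)
  · exact Nat.cast_le.2 (Nat.sub_le_iff_le_add'.2 (wittIndex_le_finrank_inf_add_length p))

theorem finrank_inf_eq_of_edist_eq {U W X : P.Generator}
    (h : P.dualPolarGraph.edist U X = P.dualPolarGraph.edist W X) :
    finrank F (U.1 ⊓ X.1 : Submodule F V) = finrank F (W.1 ⊓ X.1 : Submodule F V) := by
  rw [edist_dualPolarGraph, edist_dualPolarGraph, Nat.cast_inj] at h
  have := finrank_inf_le_wittIndex U.1 X
  have := finrank_inf_le_wittIndex W.1 X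
  omega

end Generator

section Counting

open Module Submodule

local notation "q" => (Nat.card F : ℝ)

theorem two_mul_wittIndex_symplectic [FiniteDimensional F V] (B : LinearMap.BilinForm F V)
    (alt : LinearMap.IsAlt B) (nondeg : LinearMap.Nondegenerate B) :
    2 * (symplectic B alt nondeg).wittIndex = finrank F V := by
  obtain ⟨U⟩ := nonempty_generator (symplectic B alt nondeg)
  have hperp : (symplectic B alt nondeg).perp U.1 = U.1 :=
    le_antisymm (fun v hv => mem_generator_of_mem_perp U trivial hv) U.2.1.le_perp
  have hrank := U.2.1.finrank_perp_add_finrank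
  rwa [hperp, U.2.2, ← two_mul] at hrank

variable [Finite F]

theorem one_lt_natCard : 1 < q :=
  Nat.one_lt_cast.2 Finite.one_lt_card

theorem natCard_pos : 0 < q :=
  Nat.cast_pos.2 Nat.card_pos

variable {P : ClassicalPolarSpace F V} {T W : Submodule F V} {u v : V}

/-- The parameter of the residue of a totally isotropic subspace of dimension `k`, a polar space of
Witt index `d - k`: it has `1 + q ^ (d + e - 1 - k)` times as many points as each of its
generators. -/
noncomputable def residueParam (P : ClassicalPolarSpace F V) (k : ℕ) : ℝ :=
  q ^ ((P.wittIndex : ℝ) + P.parameterE - 1 - k)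

theorem residueParam_pos (P : ClassicalPolarSpace F V) (k : ℕ) : 0 < P.residueParam k :=
  Real.rpow_pos_of_pos natCard_pos _

theorem rpow_parameterE_mul_pow [FiniteDimensional F V] (P : ClassicalPolarSpace F V) :
    q ^ P.parameterE * q ^ (2 * P.wittIndex) = P.hyperbolicOrder * q ^ finrank F V := by
  have hsub (d : ℕ) : q ^ ((finrank F V : ℝ) - 2 * d) * q ^ (2 * d) = q ^ finrank F V := by
    rw [← Real.rpow_natCast, ← Real.rpow_natCast, ← Real.rpow_add natCard_pos]
    push_cast
    rw [sub_add_cancel]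
  cases P with
  | symplectic B alt nondeg =>
    rw [two_mul_wittIndex_symplectic, parameterE, Real.rpow_one, hyperbolicOrder]
  | orthogonal Q nondeg =>
    rw [parameterE, hsub, hyperbolicOrder, Nat.cast_one, one_mul]
  | hermitian σ hσ hσσ H herm nondeg =>
    have hsqrt : q ^ (1 / 2 : ℝ) = {s | s + σ s = 0}.ncard := by
      rw [← sq_ncard_add_map_eq_zero hσ hσσ, ← Real.sqrt_eq_rpow, Nat.cast_pow,
        Real.sqrt_sq (Nat.cast_nonneg _)]
    rw [parameterE, Real.rpow_add natCard_pos, mul_right_comm, hsub, hsqrt, mul_comm,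
      hyperbolicOrder]

theorem residueParam_mul_pow [FiniteDimensional F V] (P : ClassicalPolarSpace F V) (k : ℕ) :
    P.residueParam k * q ^ (k + P.wittIndex + 1) = P.hyperbolicOrder * q ^ finrank F V := by
  rw [← rpow_parameterE_mul_pow, residueParam, ← Real.rpow_natCast, ← Real.rpow_natCast,
    ← Real.rpow_add natCard_pos, ← Real.rpow_add natCard_pos]
  congr 1
  push_cast
  ring

variable [FiniteDimensional F V]

theorem ncard_isIsotropic_sdiff_ker_mul (hu : P.IsIsotropic u) (huW : u ∈ W) :
    ({v ∈ (W \ LinearMap.ker (P.form u) : Set V) | P.IsIsotropic v}.ncard : ℝ) * q =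
      (W \ LinearMap.ker (P.form u) : Set V).ncard * P.hyperbolicOrder := by
  have : Finite V := finite_of_finite F
  set N : Set V := W \ LinearMap.ker (P.form u) with hN
  have hshift (v : V) (t : F) : v + t • u ∈ N ↔ v ∈ N := by
    simp [hN, W.add_mem_iff_left (W.smul_mem t huW), form_self hu]
  have htranslate (t : F) :
      {v ∈ N | P.IsIsotropic (v + t • u)}.ncard = {v ∈ N | P.IsIsotropic v}.ncard := by
    rw [← Set.ncard_preimage_of_injective_subset_range (s := {v ∈ N | P.IsIsotropic v})
      (Equiv.addRight (t • u)).injective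
      ((Equiv.addRight (t • u)).surjective.range_eq ▸ Set.subset_univ _)]
    congr 1
    ext v
    exact and_congr_left' (hshift v t).symm
  have hcount := ncard_mul_eq_ncard_mul_of_rel (R := ℝ)
    (fun (v : V) (t : F) => P.IsIsotropic (v + t • u)) (s := N) (t := Set.univ)
    (a := P.hyperbolicOrder)
    (fun v hv => by simpa using ncard_isIsotropic_add_smul hu hv.2)
    fun t _ => congrArg Nat.cast (htranslate t)
  rw [hcount, Set.ncard_univ, mul_comm]

theorem ncard_isIsotropic_sdiff_ker (hu : P.IsIsotropic u) (huW : u ∈ W)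
    (h : ¬ W ≤ LinearMap.ker (P.form u)) :
    ({v ∈ (W \ LinearMap.ker (P.form u) : Set V) | P.IsIsotropic v}.ncard : ℝ) * q ^ 2 =
      q ^ finrank F W * (q - 1) * P.hyperbolicOrder := by
  linear_combination q * ncard_isIsotropic_sdiff_ker_mul hu huW +
    P.hyperbolicOrder * ncard_coe_submodule_sdiff_ker h

theorem ncard_isIsotropic_perp_sdiff_generator (U : P.Generator) (hTU : T ≤ U.1) :
    ({v ∈ (P.perp T \ U.1 : Set V) | P.IsIsotropic v}.ncard : ℝ) =
      (q ^ P.wittIndex - q ^ finrank F T) * P.residueParam (finrank F T) := by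
  have : Finite V := finite_of_finite F
  have hT := U.2.1.mono hTU
  have hq : 0 < q := natCard_pos
  have hq1 : q - 1 ≠ 0 := sub_ne_zero.2 one_lt_natCard.ne'
  have hUperp : U.1 ≤ P.perp T := U.2.1.le_perp.trans (orthogonalBilin_le hTU)
  have hcount := ncard_mul_eq_ncard_mul_of_rel (fun v u => P.form u v ≠ 0)
    (s := {v ∈ (P.perp T \ U.1 : Set V) | P.IsIsotropic v}) (t := (U.1 \ T : Set V))
    (a := q ^ P.wittIndex * (q - 1) / q)
    (b := q ^ finrank F (P.perp T) * (q - 1) * P.hyperbolicOrder / q ^ 2) ?_ ?_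
  · rw [ncard_coe_submodule_sdiff hTU, U.2.2] at hcount
    have hperp := hT.finrank_perp_add_finrank
    have hparam := P.residueParam_mul_pow (finrank F T)
    rw [← hperp] at hparam
    field_simp at hcount
    refine mul_right_cancel₀ (pow_ne_zero (finrank F T + P.wittIndex + 1) hq.ne') ?_
    linear_combination q ^ finrank F T * hcount - (q ^ P.wittIndex - q ^ finrank F T) * hparam
  · rintro v ⟨⟨hvperp, hvU⟩, hv⟩
    have hcard := ncard_coe_submodule_sdiff_ker (not_generator_le_ker_form U hv hvU)
    rw [U.2.2] at hcard
    rw [eq_div_iff hq.ne', ← hcard]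
    congr 3
    ext u
    have hcomm : P.form u v = 0 ↔ P.form v u = 0 := P.isRefl_form.eq_iff
    have hT0 : u ∈ T → P.form u v = 0 := hvperp u
    simp only [Set.mem_sdiff, Set.mem_ofPred_eq, SetLike.mem_coe, LinearMap.mem_ker]
    tauto
  · rintro u ⟨huU, huT⟩
    have hu := U.2.1.isIsotropic huU
    rw [eq_div_iff (pow_ne_zero 2 hq.ne'), ← ncard_isIsotropic_sdiff_ker hu (hUperp huU)
      (not_perp_le_ker_form hT hu (hUperp huU) huT)]
    congr 3
    ext v
    have hU0 : v ∈ U.1 → P.form u v = 0 := (isTotallyIsotropic_iff.1 U.2.1).2 u huU v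
    simp only [Set.mem_sdiff, Set.mem_ofPred_eq, SetLike.mem_coe, LinearMap.mem_ker]
    tauto

theorem IsTotallyIsotropic.ncard_isIsotropic_perp_sdiff (hT : P.IsTotallyIsotropic T) :
    ({v ∈ (P.perp T \ T : Set V) | P.IsIsotropic v}.ncard : ℝ) =
      (q ^ P.wittIndex - q ^ finrank F T) * (1 + P.residueParam (finrank F T)) := by
  have : Finite V := finite_of_finite F
  obtain ⟨U, hTU⟩ := hT.exists_le_generator
  have hUperp : U.1 ≤ P.perp T := U.2.1.le_perp.trans (orthogonalBilin_le hTU)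
  have hunion : {v ∈ (P.perp T \ T : Set V) | P.IsIsotropic v} =
      (U.1 \ T : Set V) ∪ {v ∈ (P.perp T \ U.1 : Set V) | P.IsIsotropic v} := by
    ext v
    have := @hTU v
    have := @hUperp v
    have := U.2.1.isIsotropic (u := v)
    simp only [Set.mem_union, Set.mem_sdiff, Set.mem_ofPred_eq, SetLike.mem_coe]
    tauto
  rw [hunion, Set.ncard_union_eq (Set.disjoint_left.2 fun v hv hv' => hv'.1.2 hv.1),
    Nat.cast_add, ncard_coe_submodule_sdiff hTU, U.2.2,
    ncard_isIsotropic_perp_sdiff_generator U hTU, mul_one_add]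

theorem IsTotallyIsotropic.ncard_generator_ge (hT : P.IsTotallyIsotropic T) :
    ({U : P.Generator | T ≤ U.1}.ncard : ℝ) =
      ∏ i ∈ Finset.Ico (finrank F T) P.wittIndex, (1 + P.residueParam i) := by
  have : Finite V := finite_of_finite F
  induction hk : P.wittIndex - finrank F T generalizing T with
  | zero =>
    have hrank : finrank F T = P.wittIndex :=
      le_antisymm hT.finrank_le_wittIndex (Nat.sub_eq_zero_iff_le.1 hk)
    rw [hrank, Finset.Ico_self, Finset.prod_empty, Nat.cast_eq_one, Set.ncard_eq_one]
    let U₀ : P.Generator := ⟨T, hT, hrank⟩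
    refine ⟨U₀, Set.ext fun U => ⟨fun h => (Generator.eq_of_le (U := U₀) h).symm, ?_⟩⟩
    rintro rfl
    exact le_rfl (a := T)
  | succ k ih =>
    have hlt : finrank F T < P.wittIndex := by omega
    have hsub : q ^ P.wittIndex - q ^ finrank F T ≠ 0 :=
      sub_ne_zero.2 (pow_lt_pow_right₀ one_lt_natCard hlt).ne'
    have hcount := ncard_mul_eq_ncard_mul_of_rel (fun v U => v ∈ U.1)
      (s := {v ∈ (P.perp T \ T : Set V) | P.IsIsotropic v}) (t := {U : P.Generator | T ≤ U.1})
      (a := ∏ i ∈ Finset.Ico (finrank F T + 1) P.wittIndex, (1 + P.residueParam i))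
      (b := q ^ P.wittIndex - q ^ finrank F T) ?_ ?_
    · rw [hT.ncard_isIsotropic_perp_sdiff, mul_assoc, mul_comm] at hcount
      rw [Finset.prod_eq_prod_Ico_succ_bot hlt]
      exact (mul_right_cancel₀ hsub hcount).symm
    · rintro v ⟨⟨hvperp, hvT⟩, hv⟩
      rw [← finrank_sup_span_singleton hvT, ← ih (hT.sup_span_singleton hv hvperp)
        (by rw [finrank_sup_span_singleton hvT]; omega)]
      simp
    · intro U hTU
      have hcard := ncard_coe_submodule_sdiff hTU
      rw [U.2.2] at hcard
      rw [← hcard]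
      congr 2
      ext v
      have hperp : v ∈ U.1 → v ∈ P.perp T := fun hv => orthogonalBilin_le hTU (U.2.1.le_perp hv)
      have := U.2.1.isIsotropic (u := v)
      simp only [Set.mem_sdiff, Set.mem_ofPred_eq, SetLike.mem_coe]
      tauto

end Counting

section Points

open Module Submodule

local notation "q" => (Nat.card F : ℝ)

variable {P : ClassicalPolarSpace F V} {U W : Submodule F V} {v : V}

theorem Point.eq_span_singleton {x : P.Point} (hv : v ∈ x.1) (hv0 : v ≠ 0) : x.1 = span F {v} := by
  have : FiniteDimensional F x.1 := finite_of_finrank_eq_succ x.2.2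
  refine (eq_of_le_of_finrank_eq ((span_singleton_le_iff_mem v x.1).2 hv) ?_).symm
  rw [finrank_span_singleton hv0, x.2.2]

theorem Point.exists_mem_ne_zero (x : P.Point) : ∃ v ∈ x.1, v ≠ 0 := by
  refine exists_mem_ne_zero_of_ne_bot fun h => one_ne_zero (α := ℕ) ?_
  rw [← x.2.2, h, finrank_bot]

theorem IsIsotropic.existsUnique_point_mem (hv : P.IsIsotropic v) (hv0 : v ≠ 0) :
    ∃! x : P.Point, v ∈ x.1 :=
  ⟨⟨span F {v}, hv.span_singleton, finrank_span_singleton hv0⟩, mem_span_singleton_self v,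
    fun _ hx => Subtype.ext (Point.eq_span_singleton hx hv0)⟩

theorem IsTotallyIsotropic.le_of_forall_point_le (hU : P.IsTotallyIsotropic U)
    (h : ∀ x : P.Point, x.1 ≤ U → x.1 ≤ W) : U ≤ W := by
  intro v hv
  by_cases hv0 : v = 0
  · exact hv0 ▸ W.zero_mem
  obtain ⟨x, hx, -⟩ := (hU.isIsotropic hv).existsUnique_point_mem hv0
  refine h x ?_ hx
  rwa [Point.eq_span_singleton hx hv0, span_singleton_le_iff_mem]

theorem Point.perp_eq_ker_form {x : P.Point} (hv : v ∈ x.1) (hv0 : v ≠ 0) :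
    P.perp x.1 = LinearMap.ker (P.form v) := by
  ext w
  rw [Point.eq_span_singleton hv hv0, mem_perp_span_singleton, LinearMap.mem_ker]

theorem isTotallyIsotropic_sup_point {x y : P.Point} :
    P.IsTotallyIsotropic (x.1 ⊔ y.1) ↔ y.1 ≤ P.perp x.1 :=
  ⟨fun h => le_sup_right.trans (h.le_perp.trans (orthogonalBilin_le le_sup_left)),
    x.2.1.sup y.2.1⟩

variable [FiniteDimensional F V]

theorem finrank_generator_inf_perp_add_one {x : P.Point} {U : P.Generator} (hx : ¬ x.1 ≤ U.1) :
    finrank F (U.1 ⊓ P.perp x.1 : Submodule F V) + 1 = P.wittIndex := by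
  obtain ⟨v, hv, hv0⟩ := x.exists_mem_ne_zero
  have hvU : v ∉ U.1 := by rwa [← span_singleton_le_iff_mem, ← Point.eq_span_singleton hv hv0]
  have hrank := finrank_inf_ker_add_one (not_generator_le_ker_form U (x.2.1.isIsotropic hv) hvU)
  rwa [U.2.2, ← Point.perp_eq_ker_form hv hv0] at hrank

theorem finrank_sup_point {x y : P.Point} (hxy : x ≠ y) :
    finrank F (x.1 ⊔ y.1 : Submodule F V) = 2 := by
  obtain ⟨v, hv, hv0⟩ := y.exists_mem_ne_zero
  have hvx : v ∉ x.1 := fun hvx => hxy <| Subtype.ext <| by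
    rw [Point.eq_span_singleton hv hv0, Point.eq_span_singleton hvx hv0]
  rw [Point.eq_span_singleton hv hv0, finrank_sup_span_singleton hvx, x.2.2]

variable [Finite F]

theorem ncard_point_mul (S : Set P.Point) :
    (S.ncard : ℝ) * (q - 1) = {v | v ≠ 0 ∧ ∃ x ∈ S, v ∈ x.1}.ncard := by
  have : Finite V := finite_of_finite F
  rw [← mul_one ({v | _}.ncard : ℝ)]
  refine ncard_mul_eq_ncard_mul_of_rel (fun (x : P.Point) v => v ∈ x.1) (fun x hx => ?_)
    fun v hv => ?_
  · have hcard := ncard_coe_submodule_sdiff (bot_le : ⊥ ≤ x.1)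
    rw [x.2.2, finrank_bot, pow_zero, pow_one] at hcard
    rw [← hcard]
    congr 2
    ext v
    simp only [Set.mem_ofPred_eq, Set.mem_sdiff, SetLike.mem_coe, mem_bot]
    exact ⟨fun h => ⟨h.2, h.1.1⟩, fun h => ⟨⟨h.2, x, hx, h.1⟩, h.1⟩⟩
  · obtain ⟨hv0, x, hx, hvx⟩ := hv
    rw [Nat.cast_eq_one, Set.ncard_eq_one]
    refine ⟨x, Set.eq_singleton_iff_unique_mem.2 ⟨⟨hx, hvx⟩, fun y hy => ?_⟩⟩
    exact ((x.2.1.isIsotropic hvx).existsUnique_point_mem hv0).unique hy.2 hvx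

theorem IsTotallyIsotropic.ncard_point_le_mul (hU : P.IsTotallyIsotropic U) :
    ({x : P.Point | x.1 ≤ U}.ncard : ℝ) * (q - 1) = q ^ finrank F U - 1 := by
  have hcard := ncard_coe_submodule_sdiff (bot_le : ⊥ ≤ U)
  rw [finrank_bot, pow_zero] at hcard
  rw [ncard_point_mul, ← hcard]
  congr 2
  ext v
  simp only [Set.mem_ofPred_eq, Set.mem_sdiff, SetLike.mem_coe, mem_bot]
  refine ⟨fun ⟨hv0, _, hxU, hv⟩ => ⟨hxU hv, hv0⟩, fun ⟨hvU, hv0⟩ => ⟨hv0, ?_⟩⟩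
  obtain ⟨x, hx, -⟩ := (hU.isIsotropic hvU).existsUnique_point_mem hv0
  refine ⟨x, ?_, hx⟩
  rwa [Point.eq_span_singleton hx hv0, span_singleton_le_iff_mem]

theorem natCard_point_mul (P : ClassicalPolarSpace F V) :
    (Nat.card P.Point : ℝ) * (q - 1) = (q ^ P.wittIndex - 1) * (1 + P.residueParam 0) := by
  have hcard := P.isTotallyIsotropic_bot.ncard_isIsotropic_perp_sdiff
  rw [finrank_bot, pow_zero] at hcard
  rw [← Set.ncard_univ, ncard_point_mul, ← hcard]
  congr 2
  ext v
  have hperp : v ∈ P.perp ⊥ := by simp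
  simp only [Set.mem_ofPred_eq, Set.mem_sdiff, SetLike.mem_coe, mem_bot, hperp, true_and,
    Set.mem_univ]
  refine and_congr_right fun hv0 => ⟨fun ⟨x, hx⟩ => x.2.1.isIsotropic hx, fun hv => ?_⟩
  exact (hv.existsUnique_point_mem hv0).exists

end Points

section Incidence

open Module Submodule Matrix

local notation "q" => (Nat.card F : ℝ)

theorem incidenceMatrix_row_injective (P : ClassicalPolarSpace F V) :
    Function.Injective P.incidenceMatrix.row := by
  suffices hle : ∀ U W, P.incidenceMatrix.row U = P.incidenceMatrix.row W → U.1 ≤ W.1 from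
    fun U W h => Subtype.ext (le_antisymm (hle U W h) (hle W U h.symm))
  refine fun U W h => U.2.1.le_of_forall_point_le fun x hx => ?_
  have hentry := congrFun h x
  by_contra hxW
  simp [row, incidenceMatrix, hx, hxW] at hentry

/-- The number of generators through a point, defined by its product formula. -/
noncomputable def pointDegree (P : ClassicalPolarSpace F V) : ℝ :=
  ∏ i ∈ Finset.Ico 1 P.wittIndex, (1 + P.residueParam i)

variable [Finite F]

theorem pointDegree_pos (P : ClassicalPolarSpace F V) : 0 < P.pointDegree :=
  Finset.prod_pos fun i _ => add_pos one_pos (P.residueParam_pos i)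

variable [FiniteDimensional F V] {P : ClassicalPolarSpace F V}

theorem sum_incidenceMatrix_row (U : P.Generator) :
    ∑ x, P.incidenceMatrix U x = (q ^ P.wittIndex - 1) / (q - 1) := by
  have hcard := U.2.1.ncard_point_le_mul
  rw [U.2.2] at hcard
  rw [eq_div_iff (sub_ne_zero.2 one_lt_natCard.ne'), ← hcard]
  simp only [incidenceMatrix, sum_boole_eq_ncard]

theorem incidenceMatrix_row_dotProduct_row (U W : P.Generator) :
    P.incidenceMatrix.row U ⬝ᵥ P.incidenceMatrix.row W =
      (q ^ finrank F (U.1 ⊓ W.1 : Submodule F V) - 1) / (q - 1) := by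
  rw [eq_div_iff (sub_ne_zero.2 one_lt_natCard.ne'),
    ← (U.2.1.mono inf_le_left).ncard_point_le_mul]
  simp only [dotProduct, row, incidenceMatrix, mul_boole, ← ite_and, sum_boole_eq_ncard,
    le_inf_iff, and_comm]

theorem metricDimension_dualPolarGraph_le_rank (P : ClassicalPolarSpace F V) :
    metricDimension P.dualPolarGraph ≤ P.incidenceMatrix.rank := by
  refine metricDimension_le_rank P.incidenceMatrix_row_injective fun U W X h => ?_
  rw [incidenceMatrix_row_dotProduct_row, incidenceMatrix_row_dotProduct_row,
    finrank_inf_eq_of_edist_eq h]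

theorem sum_incidenceMatrix_col (x : P.Point) :
    ∑ U, P.incidenceMatrix U x = P.pointDegree := by
  have hcard := x.2.1.ncard_generator_ge
  rw [x.2.2] at hcard
  rw [pointDegree, ← hcard]
  simp only [incidenceMatrix, sum_boole_eq_ncard]

theorem transpose_incidenceMatrix_mul_self_apply (x y : P.Point) :
    (P.incidenceMatrixᵀ * P.incidenceMatrix) x y =
      {U : P.Generator | x.1 ⊔ y.1 ≤ U.1}.ncard := by
  simp only [mul_apply, transpose_apply, incidenceMatrix, mul_boole, ← ite_and,
    sum_boole_eq_ncard, sup_le_iff, and_comm]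

-- A line lies on `pointDegree / (1 + residueParam 1)` generators.
open Classical in
theorem one_add_residueParam_mul_transpose_mul_self_apply (x y : P.Point) :
    (1 + P.residueParam 1) * (P.incidenceMatrixᵀ * P.incidenceMatrix) x y =
      P.pointDegree *
        ((if y.1 ≤ P.perp x.1 then 1 else 0) + P.residueParam 1 * if y = x then 1 else 0) := by
  rw [transpose_incidenceMatrix_mul_self_apply]
  by_cases hxy : y = x
  · subst hxy
    have hcard := y.2.1.ncard_generator_ge
    rw [y.2.2] at hcard
    rw [sup_idem, hcard, if_pos y.2.1.le_perp, if_pos rfl, mul_one, mul_comm, pointDegree]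
  rw [if_neg hxy, mul_zero, add_zero]
  by_cases hperp : y.1 ≤ P.perp x.1
  · have hline := x.2.1.sup y.2.1 hperp
    have hrank := finrank_sup_point (Ne.symm hxy)
    have hd : 2 ≤ P.wittIndex := hrank ▸ hline.finrank_le_wittIndex
    rw [hline.ncard_generator_ge, hrank, if_pos hperp, mul_one, pointDegree,
      Finset.prod_eq_prod_Ico_succ_bot hd]
  · have hempty : {U : P.Generator | x.1 ⊔ y.1 ≤ U.1} = ∅ :=
      Set.eq_empty_of_forall_notMem fun U hU =>
        hperp (isTotallyIsotropic_sup_point.1 (U.2.1.mono hU))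
    rw [hempty, if_neg hperp, Set.ncard_empty, Nat.cast_zero, mul_zero, mul_zero]

theorem ncard_point_le_inf_perp_mul (x : P.Point) (U : P.Generator) :
    ({y : P.Point | y.1 ≤ U.1 ⊓ P.perp x.1}.ncard : ℝ) * (q - 1) =
      q ^ (P.wittIndex - 1) * (q - 1) * P.incidenceMatrix U x + (q ^ (P.wittIndex - 1) - 1) := by
  have hd : 1 ≤ P.wittIndex := x.2.2 ▸ x.2.1.finrank_le_wittIndex
  rw [(U.2.1.mono inf_le_left).ncard_point_le_mul, incidenceMatrix]
  split_ifs with hx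
  · rw [inf_eq_left.2 (U.2.1.le_perp.trans (orthogonalBilin_le hx)), U.2.2,
      ← mul_pow_sub_one (Nat.one_le_iff_ne_zero.1 hd)]
    ring
  · rw [Nat.eq_sub_of_add_eq (finrank_generator_inf_perp_add_one hx), mul_zero, zero_add]

theorem one_add_residueParam_mul_transpose_mul_self_mul_transpose_apply (x : P.Point)
    (U : P.Generator) :
    (1 + P.residueParam 1) *
        (P.incidenceMatrixᵀ * P.incidenceMatrix * P.incidenceMatrixᵀ) x U =
      P.pointDegree * ({y : P.Point | y.1 ≤ U.1 ⊓ P.perp x.1}.ncard +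
        P.residueParam 1 * P.incidenceMatrix U x) := by
  classical
  have hcollinear : ({y : P.Point | y.1 ≤ U.1 ⊓ P.perp x.1}.ncard : ℝ) =
      ∑ y : P.Point, (if y.1 ≤ P.perp x.1 then 1 else 0) * P.incidenceMatrix U y := by
    simp only [incidenceMatrix, mul_boole, ← ite_and, sum_boole_eq_ncard, le_inf_iff]
  have hself : P.incidenceMatrix U x =
      ∑ y, (if y = x then 1 else 0) * P.incidenceMatrix U y := by
    simp only [boole_mul, Finset.sum_ite_eq', Finset.mem_univ, if_true]
  rw [mul_apply, Finset.mul_sum, hcollinear, hself, Finset.mul_sum, ← Finset.sum_add_distrib,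
    Finset.mul_sum]
  refine Finset.sum_congr rfl fun y _ => ?_
  rw [← mul_assoc, one_add_residueParam_mul_transpose_mul_self_apply, transpose_apply]
  ring

theorem transpose_incidenceMatrix_mul_self_mul_transpose (P : ClassicalPolarSpace F V) :
    P.incidenceMatrixᵀ * P.incidenceMatrix * P.incidenceMatrixᵀ =
      (P.pointDegree / (1 + P.residueParam 1) * (q ^ (P.wittIndex - 1) + P.residueParam 1)) •
        P.incidenceMatrixᵀ +
      of fun _ _ => P.pointDegree / (1 + P.residueParam 1) *
        ((q ^ (P.wittIndex - 1) - 1) / (q - 1)) := by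
  ext x U
  have hq : q - 1 ≠ 0 := sub_ne_zero.2 one_lt_natCard.ne'
  have hx₁ : 1 + P.residueParam 1 ≠ 0 := (add_pos one_pos (P.residueParam_pos 1)).ne'
  refine mul_left_cancel₀ hx₁ ?_
  rw [one_add_residueParam_mul_transpose_mul_self_mul_transpose_apply,
    eq_div_of_mul_eq hq (ncard_point_le_inf_perp_mul x U)]
  simp only [Matrix.add_apply, Matrix.smul_apply, of_apply, transpose_apply, smul_eq_mul]
  field_simp
  ring

theorem trace_transpose_incidenceMatrix_mul_self (P : ClassicalPolarSpace F V) :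
    (P.incidenceMatrixᵀ * P.incidenceMatrix).trace = Nat.card P.Point * P.pointDegree := by
  have hdiag (x : P.Point) : (P.incidenceMatrixᵀ * P.incidenceMatrix) x x = P.pointDegree := by
    rw [transpose_incidenceMatrix_mul_self_apply, sup_idem, ← sum_incidenceMatrix_col x]
    simp only [incidenceMatrix, sum_boole_eq_ncard]
  simp only [trace, diag_apply, hdiag, Finset.sum_const, Finset.card_univ, nsmul_eq_mul,
    Nat.card_eq_fintype_card]

theorem rank_incidenceMatrix_eq_residueParam (hd : 1 ≤ P.wittIndex) :
    (P.incidenceMatrix.rank : ℝ) =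
      (1 + P.residueParam 0) * ((1 + P.residueParam 1) * (q ^ P.wittIndex - 1) -
          (q ^ (P.wittIndex - 1) - 1)) /
        ((q - 1) * (q ^ (P.wittIndex - 1) + P.residueParam 1)) := by
  have hq : 0 < q := natCard_pos
  have hq1 : q - 1 ≠ 0 := sub_ne_zero.2 one_lt_natCard.ne'
  have hs : q ^ P.wittIndex - 1 ≠ 0 :=
    (sub_pos.2 (one_lt_pow₀ one_lt_natCard (Nat.one_le_iff_ne_zero.1 hd))).ne'
  have hx₁ := P.residueParam_pos 1
  have hr := P.pointDegree_pos
  rw [cast_rank_eq_of_transpose_mul_self_mul_transpose sum_incidenceMatrix_row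
    sum_incidenceMatrix_col hr.ne' (div_ne_zero hs hq1) (by positivity)
    P.transpose_incidenceMatrix_mul_self_mul_transpose, trace_transpose_incidenceMatrix_mul_self,
    ← Nat.card_eq_fintype_card, eq_div_of_mul_eq hq1 P.natCard_point_mul]
  field_simp

theorem rank_incidenceMatrix (hd : 1 ≤ P.wittIndex) :
    (P.incidenceMatrix.rank : ℝ) =
      ((q ^ (P.wittIndex + P.parameterE - 1) + 1) *
          (q ^ (P.wittIndex + P.parameterE - 1) - q ^ (P.parameterE - 1) + q - 1)) /
        ((q ^ (P.parameterE - 1) + 1) * (q - 1)) := by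
  have hq : 0 < q := natCard_pos
  have hq1 : q - 1 ≠ 0 := sub_ne_zero.2 one_lt_natCard.ne'
  have hx₀ : q ^ (P.wittIndex + P.parameterE - 1) =
      q ^ (P.wittIndex - 1) * q * q ^ (P.parameterE - 1) := by
    rw [pow_sub_one_mul (Nat.one_le_iff_ne_zero.1 hd), ← Real.rpow_natCast, ← Real.rpow_add hq,
      add_sub_assoc]
  have hx₁ : P.residueParam 1 = q ^ (P.wittIndex - 1) * q ^ (P.parameterE - 1) := by
    rw [residueParam, Nat.cast_one, Real.rpow_sub_one hq.ne', hx₀]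
    field_simp
  have : 0 < q ^ (P.parameterE - 1) := Real.rpow_pos_of_pos hq _
  rw [rank_incidenceMatrix_eq_residueParam hd, residueParam, Nat.cast_zero, sub_zero, hx₀, hx₁,
    ← pow_sub_one_mul (Nat.one_le_iff_ne_zero.1 hd)]
  field_simp
  ring

end Incidence

end ClassicalPolarSpace

theorem theorem2p4 {F V : Type*} [Field F] [Finite F] [AddCommGroup V] [Module F V]
    [FiniteDimensional F V] (P : ClassicalPolarSpace F V) (q d : ℕ) (e : ℝ)
    (hq : q = Nat.card F) (hd : d = P.wittIndex) (hd_pos : 1 ≤ d) (he : e = P.parameterE) :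
    metricDimension P.dualPolarGraph ≤ P.incidenceMatrix.rank ∧
    (P.incidenceMatrix.rank : ℝ) =
      (((q : ℝ) ^ ((d : ℝ) + e - 1) + 1) *
          ((q : ℝ) ^ ((d : ℝ) + e - 1) - (q : ℝ) ^ (e - 1) + (q : ℝ) - 1)) /
        (((q : ℝ) ^ (e - 1) + 1) * ((q : ℝ) - 1)) ∧
    (metricDimension P.dualPolarGraph : ℝ) ≤
      (((q : ℝ) ^ ((d : ℝ) + e - 1) + 1) *
          ((q : ℝ) ^ ((d : ℝ) + e - 1) - (q : ℝ) ^ (e - 1) + (q : ℝ) - 1)) /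
        (((q : ℝ) ^ (e - 1) + 1) * ((q : ℝ) - 1)) := by
  subst hq hd he
  have hle := P.metricDimension_dualPolarGraph_le_rank
  have hrank := ClassicalPolarSpace.rank_incidenceMatrix hd_pos
  exact ⟨hle, hrank, hrank ▸ Nat.cast_le.2 hle⟩
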